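/- Let $m\ge 1$, let $A$ be a symmetric, entrywise non-negative, irreducible $m\times m$ matrix (for $m=1$, irreducible means $A\neq 0$), and let $p_1,\dots,p_m\ge 0$ with $\sum_i p_i=1$. Consider the reduced multicomponent Smoluchowski equation $$\frac{\mathrm d w_{\mathbf n}}{\mathrm dt}=\frac12\sum_{\mathbf k+\mathbf l=\mathbf n}(\mathbf k^{T}A\,\mathbf l)\,w_{\mathbf k}w_{\mathbf l}-\big(\mathbf n^{T}A\,\mathbf m(0)\big)w_{\mathbf n},\qquad \mathbf n\in\mathbb N_0^m,\qquad \mathbf m(0)_i=\sum_{\mathbf n\in\mathbb N_0^m}n_i w_{\mathbf n}(0),$$ with the monodisperse initial condition $w_{\mathbf e_i}(0)=p_i$ for $i=1,\dots,m$ and $w_{\mathbf n}(0)=0$ for all other $\mathbf n$, where $\mathbf e_i$ is the $i$-th standard basis vector. For $t\ge 0$ consider the multi-type branching process with types $1,\dots,m$ in which the offspring vectors of all individuals are independent and the offspring vector $\mathbf X_k$ of an individual of type $k$ has probability generating function $\prod_{l=1}^m\exp\big(tA_{kl}p_l(s_l-1)\big)$, i.e. independent $\mathrm{Poisson}(tA_{kl}p_l)$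 coordinates. Let $\mathbf Z_0=\mathbf e_i,\mathbf Z_1,\mathbf Z_2,\dots$ be the vectors of generation sizes of the process started from one individual of type $i$, and let $\mathbf T^{(i)}=\sum_{g\ge 0}\mathbf Z_g$ be its total progeny. Let $T_c\in(0,\infty]$ be the time $t$ at which this process is critical, i.e. at which its mean matrix $M=(\mathbb E[X_{k,l}])_{k,l}=tA\,\mathrm{diag}(p_1,\dots,p_m)$ has spectral radius $1$ ($T_c=\infty$ if there is no such $t$). Then the equation with this initial condition has a solution on $[0,T_c)$, and every solution on $[0,T_c)$ satisfies, for all $t\in(0,T_c)$, all $\mathbf n\in\mathbb N_0^m$ and every $i$ with $n_i>0$, $$w_{\mathbf n}(t)=\frac{p_i}{n_i}\,\mathbb P\big(\mathbf T^{(i)}=\mathbf n\big).$$ -/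

import Mathlib

open MeasureTheory ProbabilityTheory
open scoped ENNReal NNReal

namespace Coagulation

noncomputable section

/-! ### The reduced multicomponent Smoluchowski equation -/

/-- The coagulation kernel `K(k, l) = kᵀ A l`, for `k, l ∈ ℕ₀ᵐ`. -/
def kernel {m : ℕ} (A : Matrix (Fin m) (Fin m) ℝ) (k l : Fin m → ℕ) : ℝ :=
  ∑ i, ∑ j, (k i : ℝ) * A i j * (l j : ℝ)

/-- The total mass vector `m(t)ᵢ = ∑ₙ nᵢ wₙ(t)` of a family `w`. -/
def massVector {m : ℕ} (w : (Fin m → ℕ) → ℝ → ℝ) (t : ℝ) (i : Fin m) : ℝ :=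
  ∑' n : Fin m → ℕ, (n i : ℝ) * w n t

/-- The right-hand side
`½ ∑_{k + l = n} K(k, l) w_k w_l - (nᵀ A m(0)) w_n` of the reduced equation at time `t`.
The pairs `(k, l)` with `k + l = n` are the pairs `(k, n - k)` with `k ≤ n` coordinatewise. -/
def reducedRHS {m : ℕ} (A : Matrix (Fin m) (Fin m) ℝ) (w : (Fin m → ℕ) → ℝ → ℝ)
    (n : Fin m → ℕ) (t : ℝ) : ℝ :=
  1 / 2 * ∑ k ∈ Finset.Iic n, kernel A k (n - k) * w k t * w (n - k) t
    - (∑ i, ∑ j, (n i : ℝ) * A i j * massVector w 0 j) * w n t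

/-- `w` solves the reduced multicomponent Smoluchowski equation on `[0, T)` (with the one-sided
derivative at `0`), with the monodisperse initial condition `w_{eᵢ}(0) = pᵢ` for every `i`, and
`w_n(0) = 0` when `n` is not a standard basis vector. -/
structure IsReducedSolution {m : ℕ} (A : Matrix (Fin m) (Fin m) ℝ) (p : Fin m → ℝ) (T : ℝ≥0∞)
    (w : (Fin m → ℕ) → ℝ → ℝ) : Prop where
  initial_single : ∀ i, w (Pi.single i 1) 0 = p i
  initial_other : ∀ n, (∀ i, n ≠ Pi.single i 1) → w n 0 = 0
  equation : ∀ n t, 0 ≤ t → ENNReal.ofReal t < T →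
    HasDerivWithinAt (w n) (reducedRHS A w n t) (Set.Ici 0) t

/-! ### The multi-type branching process -/

/-- The law of the offspring vector `X_k` of an individual of type `k`: the coordinates are
independent, and the number of children of type `l` is Poisson with mean `t A_{kl} p_l`. -/
def offspringLaw {m : ℕ} (A : Matrix (Fin m) (Fin m) ℝ) (p : Fin m → ℝ) (t : ℝ) (k : Fin m) :
    Measure (Fin m → ℕ) :=
  Measure.pi fun l => poissonMeasure (t * A k l * p l).toNNReal

/-- The offspring law is the one whose probability generating function is
`G_{X_k}(s) = ∏ₗ exp (t A_{kl} p_l (s_l - 1))`. -/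
theorem offspringLaw_pgf {m : ℕ} (A : Matrix (Fin m) (Fin m) ℝ) (p : Fin m → ℝ) (t : ℝ)
    (hA : ∀ i j, 0 ≤ A i j) (hp : ∀ i, 0 ≤ p i) (ht : 0 ≤ t) (k : Fin m) (s : Fin m → ℝ) :
    ∫ x, ∏ l, s l ^ x l ∂(offspringLaw A p t k) =
      ∏ l, Real.exp (t * A k l * p l * (s l - 1)) := by
  unfold offspringLaw
  rw [integral_fintype_prod_eq_prod (f := fun l (x : ℕ) => s l ^ x)]
  refine Finset.prod_congr rfl fun l _ => ?_
  have h0 : 0 ≤ t * A k l * p l := mul_nonneg (mul_nonneg ht (hA k l)) (hp l)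
  rw [integral_poissonMeasure]
  simp only [Real.coe_toNNReal _ h0, smul_eq_mul]
  have h1 := (NormedSpace.expSeries_div_hasSum_exp (t * A k l * p l * s l)).mul_left
    (Real.exp (-(t * A k l * p l)))
  rw [← Real.exp_eq_exp_ℝ, ← Real.exp_add] at h1
  have h2 : t * A k l * p l * (s l - 1) = -(t * A k l * p l) + t * A k l * p l * s l := by ring
  rw [h2, ← h1.tsum_eq]
  refine tsum_congr fun n => ?_
  rw [mul_pow]
  ring

/-- The random vectors `X k (g, j)` (the offspring of the `j`-th individual of type `k` in
generation `g`) are jointly independent, and `X k (g, j)` has the offspring law of type `k`. -/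
structure IsOffspringFamily {m : ℕ} (A : Matrix (Fin m) (Fin m) ℝ) (p : Fin m → ℝ) (t : ℝ)
    {Ω : Type*} [MeasurableSpace Ω] (P : Measure Ω)
    (X : Fin m → ℕ × ℕ → Ω → (Fin m → ℕ)) : Prop where
  indep : iIndepFun (fun q : Fin m × (ℕ × ℕ) => X q.1 q.2) P
  law : ∀ k q, HasLaw (X k q) (offspringLaw A p t k) P

/-- The multi-type branching process started from type `i`: `Z₀ = eᵢ` and
`Z_{g+1} = ∑ₖ ∑_{j < Z_{g,k}} X_{k,(g,j)}`. -/
def generation {m : ℕ} {Ω : Type*} (X : Fin m → ℕ × ℕ → Ω → (Fin m → ℕ)) (i : Fin m) :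
    ℕ → Ω → (Fin m → ℕ)
  | 0, _ => Pi.single i 1
  | g + 1, ω => ∑ k, ∑ j ∈ Finset.range (generation X i g ω k), X k (g, j) ω

/-- The total progeny `T⁽ⁱ⁾ = ∑_g Z_g`, with values in `[0, ∞]ᵐ`. -/
def totalProgeny {m : ℕ} {Ω : Type*} (X : Fin m → ℕ × ℕ → Ω → (Fin m → ℕ)) (i : Fin m)
    (ω : Ω) (l : Fin m) : ℝ≥0∞ :=
  ∑' g : ℕ, (generation X i g ω l : ℝ≥0∞)

/-- The matrix of expected offspring numbers `M_{kl} = E[X_{k,l}]`. -/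
def meanMatrix {m : ℕ} (A : Matrix (Fin m) (Fin m) ℝ) (p : Fin m → ℝ) (t : ℝ) :
    Matrix (Fin m) (Fin m) ℝ :=
  Matrix.of fun k l => ∫ x, (x l : ℝ) ∂(offspringLaw A p t k)

/-- The branching process at parameter `t` is critical: its mean matrix has spectral radius `1`.
The spectral radius is the operator norm of the mean matrix on the Hilbert space `ℓ²(p)`, where
this matrix is self-adjoint for symmetric `A`. -/
def IsCritical {m : ℕ} (A : Matrix (Fin m) (Fin m) ℝ) (p : Fin m → ℝ) (t : ℝ) : Prop :=
  spectralRadius ℂ ((meanMatrix A p t).map (fun x : ℝ => (x : ℂ))) = 1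

/-- The critical time `T_c`: the time at which the branching process is critical
(`∞` if it never is). -/
def criticalTime {m : ℕ} (A : Matrix (Fin m) (Fin m) ℝ) (p : Fin m → ℝ) : ℝ≥0∞ :=
  ⨅ (t : ℝ) (_ : 0 ≤ t) (_ : IsCritical A p t), ENNReal.ofReal t

end

end Coagulation

namespace Coagulation

noncomputable section

/-! Let `Q i` be the formal generating function of the finite values of the total progeny from type
`i`, and `D k` the Euler derivation. Formally `Q i = X i * exp (t ∑ l, A i l p l (Q l - 1))`, hence
`D k (Q i) = δ_{ik} Q i + Q i ∑ l, t A i l p l D k (Q l)` (`euler_progenySeries`). This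
differentiated form involves only finite sums in each coefficient, so it survives the limit from
finitely many generations.

Now put `V = ∑ p i Q i - (t/2) ∑ A i j p i p j Q i Q j`, the dissymmetry of trees (vertices minus
edges). Symmetry of `A` gives `D k V = p k Q k` (`euler_clusterSeries`), so the coefficient `v n`
satisfies `n k * v n = p k * P(T = n)` with `T` started from type `k`. It also gives `∑ k, D k V - V
= (t/2) ∑ A i j (D i V)(D j V)`, that is, `(|n| - 1) v n = (t/2) ∑ K(k, n-k) v k v (n-k)`.

The equation is triangular in `|n|`: its unique solution (`IsReducedSolution.unique`) is `t^(|n|-1)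
exp(-nᵀ A p t) a n`, and at each fixed `t` it obeys the same recursion
(`explicitSolution_recursion`). The recursion leaves free only the values at unit vectors
(`eq_of_recursion`). These agree, because both are `p i` times the probability of having no
children. -/

/-! ### Euler derivations on formal power series -/

/-- The underlying function of the Euler derivation `euler`. -/
def eulerFun {σ S : Type*} [CommSemiring S] (k : σ) (f : MvPowerSeries σ S) :
    MvPowerSeries σ S :=
  fun n => (n k : S) * MvPowerSeries.coeff n f

theorem coeff_eulerFun {σ S : Type*} [CommSemiring S] (k : σ) (f : MvPowerSeries σ S)
    (n : σ →₀ ℕ) :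
    MvPowerSeries.coeff n (eulerFun k f) = (n k : S) * MvPowerSeries.coeff n f := rfl

open MvPowerSeries in
/-- The Euler derivation `X_k ∂/∂X_k` of formal power series, multiplying the coefficient of
`X ^ n` by `n k`. -/
def euler {σ S : Type*} [CommSemiring S] (k : σ) :
    Derivation S (MvPowerSeries σ S) (MvPowerSeries σ S) where
  toFun := eulerFun k
  map_add' f g := by
    ext n
    simp only [coeff_eulerFun, map_add, mul_add]
  map_smul' c f := by
    ext n
    simp only [coeff_eulerFun, RingHom.id_apply, map_smul, smul_eq_mul]
    ring
  map_one_eq_zero' := by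
    classical
    ext n
    change coeff n (eulerFun k 1) = 0
    rw [coeff_eulerFun, coeff_one]
    split_ifs with h <;> simp [h]
  leibniz' f g := by
    classical
    ext n
    change coeff n (eulerFun k (f * g)) = coeff n (f • eulerFun k g + g • eulerFun k f)
    rw [smul_eq_mul, smul_eq_mul, mul_comm g, map_add, coeff_eulerFun, coeff_mul, coeff_mul,
      coeff_mul, Finset.mul_sum, ← Finset.sum_add_distrib]
    refine Finset.sum_congr rfl fun x hx => ?_
    rw [coeff_eulerFun, coeff_eulerFun, ← Finset.HasAntidiagonal.mem_antidiagonal.1 hx, Finsupp.add_apply,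
      Nat.cast_add]
    ring

theorem coeff_euler {σ S : Type*} [CommSemiring S] (k : σ) (f : MvPowerSeries σ S)
    (n : σ →₀ ℕ) :
    MvPowerSeries.coeff n (euler k f) = (n k : S) * MvPowerSeries.coeff n f := rfl

theorem euler_X {σ S : Type*} [CommSemiring S] [DecidableEq σ] (k i : σ) :
    euler k (MvPowerSeries.X i : MvPowerSeries σ S) = if i = k then MvPowerSeries.X i else 0 := by
  ext n
  rw [coeff_euler, MvPowerSeries.coeff_X]
  by_cases h : n = Finsupp.single i 1
  · subst h
    by_cases hik : i = k
    · subst hik; simp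
    · simp [hik]
  · split_ifs <;> simp [h, MvPowerSeries.coeff_X]

/-! ### Coefficientwise expectations of formal power series -/

/-- The coefficientwise expectation of a random formal power series. -/
def expect {σ α : Type*} [MeasurableSpace α] (μ : Measure α) (f : α → MvPowerSeries σ ℝ≥0∞) :
    MvPowerSeries σ ℝ≥0∞ :=
  fun n => ∫⁻ a, MvPowerSeries.coeff n (f a) ∂μ

theorem coeff_expect {σ α : Type*} [MeasurableSpace α] (μ : Measure α)
    (f : α → MvPowerSeries σ ℝ≥0∞) (n : σ →₀ ℕ) :
    MvPowerSeries.coeff n (expect μ f) = ∫⁻ a, MvPowerSeries.coeff n (f a) ∂μ := rfl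

theorem expect_const {σ α : Type*} [MeasurableSpace α] (μ : Measure α) [IsProbabilityMeasure μ]
    (c : MvPowerSeries σ ℝ≥0∞) : expect μ (fun _ => c) = c := by
  ext n
  simp [coeff_expect]

theorem expect_const_mul {σ α : Type*} [MeasurableSpace α] [DiscreteMeasurableSpace α]
    (μ : Measure α) (c : MvPowerSeries σ ℝ≥0∞) (f : α → MvPowerSeries σ ℝ≥0∞) :
    expect μ (fun a => c * f a) = c * expect μ f := by
  classical
  ext n
  simp only [coeff_expect, MvPowerSeries.coeff_mul]
  rw [lintegral_finsetSum _ fun _ _ => .of_discrete]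
  refine Finset.sum_congr rfl fun x _ => ?_
  rw [lintegral_const_mul _ .of_discrete]

theorem euler_expect {σ α : Type*} [MeasurableSpace α] [DiscreteMeasurableSpace α]
    (μ : Measure α) (k : σ) (f : α → MvPowerSeries σ ℝ≥0∞) :
    euler k (expect μ f) = expect μ (fun a => euler k (f a)) := by
  ext n
  simp only [coeff_expect, coeff_euler]
  rw [lintegral_const_mul _ .of_discrete]

theorem measurable_coeff_comp {σ Ω β : Type*} [MeasurableSpace Ω] [MeasurableSpace β]
    [DiscreteMeasurableSpace β] {Y : Ω → β} (hY : Measurable Y) (f : β → MvPowerSeries σ ℝ≥0∞)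
    (n : σ →₀ ℕ) : Measurable fun ω => MvPowerSeries.coeff n (f (Y ω)) :=
  (Measurable.of_discrete (f := fun v => MvPowerSeries.coeff n (f v))).comp hY

theorem expect_map {σ α β : Type*} [MeasurableSpace α] [MeasurableSpace β]
    [DiscreteMeasurableSpace β] (μ : Measure α) {Y : α → β} (hY : Measurable Y)
    (f : β → MvPowerSeries σ ℝ≥0∞) : expect (μ.map Y) f = expect μ (fun a => f (Y a)) := by
  ext n
  simp only [coeff_expect]
  rw [lintegral_map .of_discrete hY]

/-- A coefficient of a product is a finite sum of products, so independence applies term by term.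
With values in `ℝ≥0∞` no integrability is needed. -/
theorem expect_mul_of_indepFun {σ Ω β γ : Type*} [MeasurableSpace Ω] {μ : Measure Ω}
    [MeasurableSpace β] [DiscreteMeasurableSpace β] [MeasurableSpace γ]
    [DiscreteMeasurableSpace γ] {Y : Ω → β} {Z : Ω → γ} (hY : Measurable Y) (hZ : Measurable Z)
    (h : IndepFun Y Z μ) (f : β → MvPowerSeries σ ℝ≥0∞) (g : γ → MvPowerSeries σ ℝ≥0∞) :
    expect μ (fun ω => f (Y ω) * g (Z ω)) =
      expect μ (fun ω => f (Y ω)) * expect μ (fun ω => g (Z ω)) := by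
  classical
  ext n
  have hf := measurable_coeff_comp hY f
  have hg := measurable_coeff_comp hZ g
  simp only [coeff_expect, MvPowerSeries.coeff_mul]
  rw [lintegral_finsetSum _ fun x _ => Measurable.fun_mul (hf x.1) (hg x.2)]
  refine Finset.sum_congr rfl fun x _ => ?_
  exact lintegral_mul_eq_lintegral_mul_lintegral_of_indepFun (hf x.1) (hg x.2)
    (h.comp (φ := fun v => MvPowerSeries.coeff x.1 (f v))
      (ψ := fun v => MvPowerSeries.coeff x.2 (g v)) .of_discrete .of_discrete)

theorem expect_prod_of_iIndepFun {σ Ω ι β : Type*} [MeasurableSpace Ω] {μ : Measure Ω}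
    [IsProbabilityMeasure μ]
    [MeasurableSpace β] [Countable β] [DiscreteMeasurableSpace β] {Y : ι → Ω → β}
    (hY : ∀ i, Measurable (Y i)) (h : iIndepFun Y μ) (f : ι → β → MvPowerSeries σ ℝ≥0∞)
    (s : Finset ι) :
    expect μ (fun ω => ∏ i ∈ s, f i (Y i ω)) = ∏ i ∈ s, expect μ (fun ω => f i (Y i ω)) := by
  classical
  induction s using Finset.induction_on with
  | empty => simp [expect_const]
  | insert j s hj ih =>
    simp only [Finset.prod_insert hj]
    rw [← ih]
    have hi := h.indepFun_finset {j} s (by simpa using hj) hY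
    have := expect_mul_of_indepFun (by fun_prop) (by fun_prop) hi
      (fun v => f j (v ⟨j, by simp⟩)) (fun v => ∏ i : s, f i (v i))
    simpa only [fun ω => Finset.prod_coe_sort s (fun i => f i (Y i ω))] using this

/-! ### Poisson offspring -/

theorem lintegral_poissonMeasure (r : ℝ≥0) (f : ℕ → ℝ≥0∞) :
    ∫⁻ j, f j ∂(poissonMeasure r) =
      ∑' j, ENNReal.ofReal (Real.exp (-r) * r ^ j / (j.factorial : ℝ)) * f j := by
  rw [lintegral_countable']
  simp only [poissonMeasure_singleton, mul_comm]

/-- The Stein identity of the Poisson law, from `j * r^j / j! = r * r^(j-1) / (j-1)!`. The truncated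
`j - 1` at `j = 0` is harmless because its weight is zero. -/
theorem lintegral_mul_poissonMeasure (r : ℝ≥0) (f : ℕ → ℝ≥0∞) :
    ∫⁻ j, (j : ℝ≥0∞) * f (j - 1) ∂(poissonMeasure r) = r * ∫⁻ j, f j ∂(poissonMeasure r) := by
  rw [lintegral_poissonMeasure, lintegral_poissonMeasure, tsum_eq_zero_add' ENNReal.summable,
    ← ENNReal.tsum_mul_left]
  simp only [Nat.cast_zero, zero_mul, mul_zero, zero_add]
  refine tsum_congr fun j => ?_
  rw [← mul_assoc, ← mul_assoc, ← ENNReal.ofReal_natCast, ← ENNReal.ofReal_coe_nnreal,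
    ← ENNReal.ofReal_mul (by positivity), ← ENNReal.ofReal_mul (by positivity), Nat.add_sub_cancel]
  congr 2
  rw [Nat.factorial_succ]
  push_cast
  field_simp
  ring

/-- The composition of the probability generating function of `Poisson(r)` with a power series. -/
def poissonSeries {σ : Type*} (r : ℝ≥0) (u : MvPowerSeries σ ℝ≥0∞) : MvPowerSeries σ ℝ≥0∞ :=
  expect (poissonMeasure r) (fun j => u ^ j)

/-- The chain rule for `exp (r (u - 1))`, obtained without composing series: Leibniz turns `u ^ j`
into `j * u ^ (j - 1)`, and the Stein identity absorbs the factor `j`. -/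
theorem euler_poissonSeries {σ : Type*} (k : σ) (r : ℝ≥0) (u : MvPowerSeries σ ℝ≥0∞) :
    euler k (poissonSeries r u) = MvPowerSeries.C (r : ℝ≥0∞) * (euler k u * poissonSeries r u) := by
  rw [poissonSeries, euler_expect, ← expect_const_mul]
  ext n
  rw [MvPowerSeries.coeff_C_mul]
  simp only [coeff_expect, Derivation.leibniz_pow]
  rw [← lintegral_mul_poissonMeasure r (fun j => MvPowerSeries.coeff n (euler k u * u ^ j))]
  refine lintegral_congr fun j => ?_
  rw [smul_eq_mul, nsmul_eq_mul, mul_comm (u ^ _), ← map_natCast (MvPowerSeries.C (σ := σ)),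
    MvPowerSeries.coeff_C_mul]

theorem constantCoeff_poissonSeries {σ : Type*} (r : ℝ≥0) (u : MvPowerSeries σ ℝ≥0∞)
    (hu : MvPowerSeries.constantCoeff u = 0) :
    MvPowerSeries.constantCoeff (poissonSeries r u) = ENNReal.ofReal (Real.exp (-r)) := by
  rw [← MvPowerSeries.coeff_zero_eq_constantCoeff_apply, poissonSeries, coeff_expect,
    lintegral_poissonMeasure, tsum_eq_single 0]
  · simp
  · intro j hj
    simp [hu, hj]

/-! ### Vector monomials and the offspring generating function -/

/-- The monomial `∏ₗ u_l ^ y_l` in a family `u` of power series. -/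
def vecPow {m : ℕ} {S : Type*} [CommSemiring S] (u : Fin m → S) (y : Fin m → ℕ) : S :=
  ∏ l, u l ^ y l

theorem vecPow_add {m : ℕ} {S : Type*} [CommSemiring S] (u : Fin m → S) (y z : Fin m → ℕ) :
    vecPow u (y + z) = vecPow u y * vecPow u z := by
  simp [vecPow, pow_add, Finset.prod_mul_distrib]

theorem vecPow_sum {m : ℕ} {S ι : Type*} [CommSemiring S] (u : Fin m → S) (s : Finset ι)
    (y : ι → Fin m → ℕ) : vecPow u (∑ i ∈ s, y i) = ∏ i ∈ s, vecPow u (y i) := by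
  simp only [vecPow, Finset.sum_apply, ← Finset.prod_pow_eq_pow_sum]
  exact Finset.prod_comm

theorem vecPow_mul {m : ℕ} {S : Type*} [CommSemiring S] (u v : Fin m → S) (y : Fin m → ℕ) :
    vecPow (fun l => u l * v l) y = vecPow u y * vecPow v y := by
  simp [vecPow, mul_pow, Finset.prod_mul_distrib]

theorem vecPow_single {m : ℕ} {S : Type*} [CommSemiring S] (u : Fin m → S) (i : Fin m) :
    vecPow u (Pi.single i 1) = u i := by
  rw [vecPow, Finset.prod_eq_single i] <;> simp +contextual

theorem coeff_vecPow_X {m : ℕ} (y : Fin m → ℕ) (n : Fin m →₀ ℕ) :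
    MvPowerSeries.coeff n (vecPow (fun l => (MvPowerSeries.X l : MvPowerSeries (Fin m) ℝ≥0∞)) y) =
      if y = n then 1 else 0 := by
  have h : vecPow (fun l => (MvPowerSeries.X l : MvPowerSeries (Fin m) ℝ≥0∞)) y =
      MvPowerSeries.monomial (Finsupp.equivFunOnFinite.symm y) 1 := by
    rw [MvPowerSeries.monomial_one_eq, Finsupp.prod_fintype _ _ (by simp)]
    rfl
  rw [h, MvPowerSeries.coeff_monomial]
  refine if_congr ?_ rfl rfl
  rw [Equiv.eq_symm_apply, eq_comm]
  rfl

/-- The composition of the probability generating function of the offspring law of type `k` with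
a family of power series. -/
def offspringSeries {m : ℕ} (A : Matrix (Fin m) (Fin m) ℝ) (p : Fin m → ℝ) (t : ℝ) (k : Fin m)
    (u : Fin m → MvPowerSeries (Fin m) ℝ≥0∞) : MvPowerSeries (Fin m) ℝ≥0∞ :=
  ∏ l, poissonSeries (t * A k l * p l).toNNReal (u l)

theorem expect_offspringLaw {m : ℕ} (A : Matrix (Fin m) (Fin m) ℝ) (p : Fin m → ℝ) (t : ℝ)
    (k : Fin m) (u : Fin m → MvPowerSeries (Fin m) ℝ≥0∞) :
    expect (offspringLaw A p t k) (vecPow u) = offspringSeries A p t k u := by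
  unfold offspringLaw offspringSeries vecPow poissonSeries
  have hind := iIndepFun_pi (μ := fun l => poissonMeasure (t * A k l * p l).toNNReal)
    (X := fun _ => id) fun _ => aemeasurable_id
  rw [expect_prod_of_iIndepFun (Y := fun l (x : Fin m → ℕ) => x l) (fun l => by fun_prop) hind
    (fun l j => u l ^ j)]
  refine Finset.prod_congr rfl fun l _ => ?_
  rw [← expect_map _ (measurable_pi_apply l) (fun j => u l ^ j), (measurePreserving_eval _ l).map_eq]

theorem euler_prod {σ S ι : Type*} [CommSemiring S] (k : σ)
    (f g : ι → MvPowerSeries σ S) (s : Finset ι) (h : ∀ i, euler k (f i) = g i * f i) :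
    euler k (∏ i ∈ s, f i) = (∑ i ∈ s, g i) * ∏ i ∈ s, f i := by
  classical
  induction s using Finset.induction_on with
  | empty => simp
  | insert j s hj ih =>
    rw [Finset.prod_insert hj, Finset.sum_insert hj, Derivation.leibniz, ih, h, smul_eq_mul,
      smul_eq_mul]
    ring

theorem euler_offspringSeries {m : ℕ} (A : Matrix (Fin m) (Fin m) ℝ) (p : Fin m → ℝ) (t : ℝ)
    (i k : Fin m) (u : Fin m → MvPowerSeries (Fin m) ℝ≥0∞) :
    euler k (offspringSeries A p t i u) =
      (∑ l, MvPowerSeries.C ((t * A i l * p l).toNNReal : ℝ≥0∞) * euler k (u l)) *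
        offspringSeries A p t i u :=
  euler_prod k _ _ _ fun l => by rw [euler_poissonSeries, mul_assoc (MvPowerSeries.C _)]

/-! ### The generating function of the truncated total progeny -/

/-- The population `∑_{h ≤ g} Z_h` of the generations up to `g`. -/
def population {m : ℕ} {Ω : Type*} (X : Fin m → ℕ × ℕ → Ω → (Fin m → ℕ)) (i : Fin m) (g : ℕ)
    (ω : Ω) : Fin m → ℕ :=
  ∑ h ∈ Finset.range (g + 1), generation X i h ω

/-- The children in generation `g + 1` if generation `g` has sizes `z`. -/
def children {m : ℕ} {Ω : Type*} (X : Fin m → ℕ × ℕ → Ω → (Fin m → ℕ)) (g : ℕ)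
    (z : Fin m → ℕ) (ω : Ω) : Fin m → ℕ :=
  ∑ k, ∑ j ∈ Finset.range (z k), X k (g, j) ω

theorem generation_succ {m : ℕ} {Ω : Type*} (X : Fin m → ℕ × ℕ → Ω → (Fin m → ℕ)) (i : Fin m)
    (g : ℕ) (ω : Ω) : generation X i (g + 1) ω = children X g (generation X i g ω) ω := rfl

theorem population_zero {m : ℕ} {Ω : Type*} (X : Fin m → ℕ × ℕ → Ω → (Fin m → ℕ)) (i : Fin m)
    (ω : Ω) : population X i 0 ω = Pi.single i 1 := by
  simp [population, generation]

theorem population_succ {m : ℕ} {Ω : Type*} (X : Fin m → ℕ × ℕ → Ω → (Fin m → ℕ)) (i : Fin m)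
    (g : ℕ) (ω : Ω) :
    population X i (g + 1) ω = population X i g ω + generation X i (g + 1) ω :=
  Finset.sum_range_succ _ _

/-- The law of total probability over the countably many values of `Z`. It replaces a random
generation size by a fixed one. -/
theorem expect_eq_tsum {σ Ω β : Type*} [MeasurableSpace Ω] {P : Measure Ω} [MeasurableSpace β] [Countable β] [DecidableEq β]
    [MeasurableSingletonClass β] {Z : Ω → β} (hZ : Measurable Z) (f : Ω → MvPowerSeries σ ℝ≥0∞)
    (hf : ∀ n, Measurable fun ω => MvPowerSeries.coeff n (f ω)) (n : σ →₀ ℕ) :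
    MvPowerSeries.coeff n (expect P f) =
      ∑' z, MvPowerSeries.coeff n (expect P fun ω => if Z ω = z then f ω else 0) := by
  simp only [coeff_expect]
  rw [← lintegral_tsum]
  · refine lintegral_congr fun ω => ?_
    rw [tsum_eq_single (Z ω)]
    · simp
    · intro z hz
      simp [hz.symm]
  · intro z
    refine Measurable.aemeasurable ?_
    have : (fun ω => MvPowerSeries.coeff n (if Z ω = z then f ω else 0)) =
        (Z ⁻¹' {z}).indicator fun ω => MvPowerSeries.coeff n (f ω) := by
      ext ω
      by_cases hz : Z ω = z <;> simp [hz]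
    rw [this]
    exact (hf n).indicator (hZ (measurableSet_singleton z))

/-! ### Independence of successive generations -/

/-- The σ-algebra generated by the offspring of the individuals whose generation lies in `G`. -/
@[reducible]
def offspringSigma {m : ℕ} {Ω : Type*} (X : Fin m → ℕ × ℕ → Ω → (Fin m → ℕ)) (G : Set ℕ) :
    MeasurableSpace Ω :=
  ⨆ q ∈ {q : Fin m × (ℕ × ℕ) | q.2.1 ∈ G}, MeasurableSpace.comap (X q.1 q.2) inferInstance

section

variable {m : ℕ} {Ω : Type*} {X : Fin m → ℕ × ℕ → Ω → (Fin m → ℕ)}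

theorem offspringSigma_mono {G H : Set ℕ} (h : G ⊆ H) :
    offspringSigma X G ≤ offspringSigma X H :=
  biSup_mono fun _ hq => h hq

theorem measurable_offspringSigma {G : Set ℕ} {g : ℕ} (hg : g ∈ G) (k : Fin m) (j : ℕ) :
    Measurable[offspringSigma X G] (X k (g, j)) :=
  (comap_measurable (X k (g, j))).mono
    (le_biSup (fun q : Fin m × (ℕ × ℕ) => MeasurableSpace.comap (X q.1 q.2) inferInstance)
      (show ((k, (g, j)) : Fin m × (ℕ × ℕ)) ∈ {q : Fin m × (ℕ × ℕ) | q.2.1 ∈ G} from hg)) le_rfl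

theorem measurable_children {G : Set ℕ} {g : ℕ} (hg : g ∈ G) (z : Fin m → ℕ) :
    Measurable[offspringSigma X G] (children X g z) := by
  let _ := offspringSigma X G
  exact Finset.measurable_fun_sum _ fun k _ => Finset.measurable_fun_sum _ fun j _ =>
    measurable_offspringSigma hg k j

theorem measurable_generation (i : Fin m) (g : ℕ) :
    Measurable[offspringSigma X (Set.Iio g)] (generation X i g) := by
  induction g with
  | zero => exact @measurable_const _ _ (_) (_) _
  | succ g ih =>
    let _ := offspringSigma X (Set.Iio (g + 1))
    have h1 : Measurable (generation X i g) :=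
      ih.mono (offspringSigma_mono (Set.Iio_subset_Iio g.le_succ)) le_rfl
    -- The number of summands is random, but it takes countably many values, so measurability for
    -- each fixed `z` suffices.
    have h2 : Measurable fun q : Ω × (Fin m → ℕ) => children X g q.2 q.1 :=
      measurable_from_prod_countable_left fun z => measurable_children (Set.mem_Iio.2 g.lt_succ_self) z
    exact h2.comp (measurable_id.prodMk h1)

theorem measurable_population (i : Fin m) (g : ℕ) :
    Measurable[offspringSigma X (Set.Iio g)] (population X i g) := by
  let _ := offspringSigma X (Set.Iio g)
  refine Finset.measurable_fun_sum _ fun h hh => ?_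
  exact (measurable_generation i h).mono (offspringSigma_mono (Set.Iio_subset_Iio (by
    simpa [Nat.lt_succ_iff] using hh))) le_rfl

variable [MeasurableSpace Ω] {P : Measure Ω}

theorem offspringSigma_le (hX : ∀ k q, Measurable (X k q)) (G : Set ℕ) :
    offspringSigma X G ≤ ‹MeasurableSpace Ω› :=
  iSup₂_le fun q _ => (hX q.1 q.2).comap_le

/-- The sizes up to generation `g` are determined by offspring of generations strictly below `g`,
whereas for fixed `z` the children come from offspring of generation `g` alone. These are disjoint
subfamilies of an independent family. -/
theorem indepFun_children (hX : ∀ k q, Measurable (X k q))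
    (hind : iIndepFun (fun q : Fin m × (ℕ × ℕ) => X q.1 q.2) P) (i : Fin m) (g : ℕ)
    (z : Fin m → ℕ) :
    IndepFun (fun ω => (population X i g ω, generation X i g ω)) (children X g z) P := by
  have h : Indep (offspringSigma X (Set.Iio g)) (offspringSigma X {g}) P := by
    have hle : ∀ q : Fin m × (ℕ × ℕ), MeasurableSpace.comap (X q.1 q.2) MeasurableSpace.pi ≤
        ‹MeasurableSpace Ω› := fun q => (hX q.1 q.2).comap_le
    refine indep_iSup_of_disjoint (S := {q : Fin m × (ℕ × ℕ) | q.2.1 ∈ Set.Iio g})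
      (T := {q : Fin m × (ℕ × ℕ) | q.2.1 ∈ ({g} : Set ℕ)}) hle ((iIndepFun_iff_iIndep _ _ _).1 hind) ?_
    rw [Set.disjoint_left]
    intro q hq hq'
    exact (ne_of_lt hq) hq'
  refine indep_of_indep_of_le_left (indep_of_indep_of_le_right h ?_) ?_
  · exact (measurable_children (Set.mem_singleton g) z).comap_le
  · exact (Measurable.prodMk (measurable_population i g) (measurable_generation i g)).comap_le

variable {A : Matrix (Fin m) (Fin m) ℝ} {p : Fin m → ℝ} {t : ℝ} [IsProbabilityMeasure P]

theorem expect_vecPow_children (hX : ∀ k q, Measurable (X k q)) (h : IsOffspringFamily A p t P X)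
    (g : ℕ) (z : Fin m → ℕ) (u : Fin m → MvPowerSeries (Fin m) ℝ≥0∞) :
    expect P (fun ω => vecPow u (children X g z ω)) =
      vecPow (fun k => offspringSeries A p t k u) z := by
  have hs : ∀ ω, vecPow u (children X g z ω) =
      ∏ r ∈ (Finset.univ : Finset (Fin m)).sigma fun k => Finset.range (z k),
        vecPow u (X r.1 (g, r.2) ω) := fun ω => by
    rw [children, ← vecPow_sum, Finset.sum_sigma]
  have hind : iIndepFun (fun r : (_ : Fin m) × ℕ => X r.1 (g, r.2)) P :=
    h.indep.precomp (g := fun r : (_ : Fin m) × ℕ => ((r.1, (g, r.2)) : Fin m × (ℕ × ℕ)))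
      (by rintro ⟨a, b⟩ ⟨c, d⟩ hh; simp_all)
  simp only [hs]
  rw [expect_prod_of_iIndepFun (fun r => hX _ _) hind (fun _ => vecPow u), Finset.prod_sigma, vecPow]
  refine Finset.prod_congr rfl fun k _ => ?_
  have hk : ∀ j, expect P (fun ω => vecPow u (X k (g, j) ω)) = offspringSeries A p t k u :=
    fun j => by
      rw [← expect_map _ (hX k (g, j)) (vecPow u), (h.law k (g, j)).map_eq, expect_offspringLaw]
  simp [hk]

/-- One step of the branching process. -/
theorem expect_population_mul_generation_succ (hX : ∀ k q, Measurable (X k q))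
    (h : IsOffspringFamily A p t P X) (i : Fin m) (g : ℕ)
    (v u : Fin m → MvPowerSeries (Fin m) ℝ≥0∞) :
    expect P (fun ω => vecPow v (population X i g ω) * vecPow u (generation X i (g + 1) ω)) =
      expect P (fun ω => vecPow v (population X i g ω) *
        vecPow (fun k => offspringSeries A p t k u) (generation X i g ω)) := by
  have hG : ∀ g, Measurable (generation X i g) := fun g =>
    (measurable_generation i g).mono (offspringSigma_le hX _) le_rfl
  have hS : Measurable (population X i g) :=
    (measurable_population i g).mono (offspringSigma_le hX _) le_rfl
  have hC : ∀ z, Measurable (children X g z) := fun z =>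
    (measurable_children (Set.mem_singleton g) z).mono (offspringSigma_le hX _) le_rfl
  ext n
  rw [expect_eq_tsum (hG g) _ (measurable_coeff_comp (hS.prodMk (hG (g + 1)))
      fun y => vecPow v y.1 * vecPow u y.2),
    expect_eq_tsum (hG g) _ (measurable_coeff_comp (hS.prodMk (hG g))
      fun y => vecPow v y.1 * vecPow (fun k => offspringSeries A p t k u) y.2)]
  refine tsum_congr fun z => ?_
  congr 1
  -- Restricted to the event that generation `g` equals `z`, the factor from its children splits
  -- off. Taking `f` random and then constant yields the same product on both sides.
  have hkey := fun f : (Fin m → ℕ) → MvPowerSeries (Fin m) ℝ≥0∞ =>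
    expect_mul_of_indepFun (hS.prodMk (hG g)) (hC z) (indepFun_children hX h.indep i g z)
      (fun y => if y.2 = z then vecPow v y.1 else 0) f
  have h1 := hkey (vecPow u)
  have h2 := hkey fun _ => vecPow (fun k => offspringSeries A p t k u) z
  rw [expect_vecPow_children hX h] at h1
  rw [expect_const] at h2
  rw [← h2] at h1
  convert h1 using 2 with ω ω
  · ext ω
    by_cases hz : generation X i g ω = z
    · simp [hz, generation_succ]
    · simp [hz]
  · ext ω
    by_cases hz : generation X i g ω = z <;> simp [hz]

/-! ### Iteration of the generating functions -/

/-- The generating functions of the population up to generation `g`, defined by iteration. -/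
def populationSeries (A : Matrix (Fin m) (Fin m) ℝ) (p : Fin m → ℝ) (t : ℝ) :
    ℕ → Fin m → MvPowerSeries (Fin m) ℝ≥0∞
  | 0 => fun i => MvPowerSeries.X i
  | g + 1 => fun i => MvPowerSeries.X i * offspringSeries A p t i (populationSeries A p t g)

/-- Each individual of generation `g + 1` carries the series of its descendants to depth `d`. One
branching step moves the weights back to generation `g`, where the factor `X` of each parent raises
the depth to `d + 1`; thus `g` is traded for `d`. -/
theorem expect_population_mul_generation (hX : ∀ k q, Measurable (X k q))
    (h : IsOffspringFamily A p t P X) (i : Fin m) (d g : ℕ) :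
    expect P (fun ω => vecPow (fun l => (MvPowerSeries.X l : MvPowerSeries (Fin m) ℝ≥0∞))
        (population X i g ω) * vecPow (populationSeries A p t d) (generation X i (g + 1) ω)) =
      populationSeries A p t (g + 1 + d) i := by
  induction g generalizing d with
  | zero =>
    rw [expect_population_mul_generation_succ hX h]
    simp only [population_zero, generation, vecPow_single, expect_const]
    rw [Nat.zero_add, Nat.add_comm]
    rfl
  | succ g ih =>
    rw [expect_population_mul_generation_succ hX h]
    simp only [population_succ X i g, vecPow_add, mul_assoc, ← vecPow_mul]
    rw [show g + 1 + 1 + d = g + 1 + (d + 1) by ring, ← ih (d + 1)]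
    rfl

theorem expect_population (hX : ∀ k q, Measurable (X k q))
    (h : IsOffspringFamily A p t P X) (i : Fin m) (g : ℕ) :
    expect P (fun ω => vecPow (fun l => (MvPowerSeries.X l : MvPowerSeries (Fin m) ℝ≥0∞))
        (population X i g ω)) = populationSeries A p t g i := by
  cases g with
  | zero => simp only [population_zero, vecPow_single, expect_const, populationSeries]
  | succ g =>
    rw [show populationSeries A p t (g + 1) i = populationSeries A p t (g + 1 + 0) i from rfl,
      ← expect_population_mul_generation hX h i 0 g]
    simp only [population_succ, vecPow_add]
    rfl

theorem measure_population (hX : ∀ k q, Measurable (X k q))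
    (h : IsOffspringFamily A p t P X) (i : Fin m) (g : ℕ) (n : Fin m →₀ ℕ) :
    P {ω | population X i g ω = n} = MvPowerSeries.coeff n (populationSeries A p t g i) := by
  have hS : Measurable (population X i g) :=
    (measurable_population i g).mono (offspringSigma_le hX _) le_rfl
  rw [← expect_population hX h, coeff_expect, ← lintegral_indicator_one]
  · refine lintegral_congr fun ω => ?_
    rw [coeff_vecPow_X, Set.indicator_apply]
    rfl
  · exact hS (measurableSet_singleton (n : Fin m → ℕ))

theorem constantCoeff_populationSeries (A : Matrix (Fin m) (Fin m) ℝ) (p : Fin m → ℝ) (t : ℝ)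
    (g : ℕ) (i : Fin m) : MvPowerSeries.constantCoeff (populationSeries A p t g i) = 0 := by
  cases g <;> simp [populationSeries]

theorem euler_populationSeries (A : Matrix (Fin m) (Fin m) ℝ) (p : Fin m → ℝ) (t : ℝ)
    (g : ℕ) (i k : Fin m) :
    euler k (populationSeries A p t (g + 1) i) =
      (if i = k then populationSeries A p t (g + 1) i else 0) +
        ∑ l, MvPowerSeries.C ((t * A i l * p l).toNNReal : ℝ≥0∞) *
          (populationSeries A p t (g + 1) i * euler k (populationSeries A p t g l)) := by
  simp only [populationSeries]
  rw [Derivation.leibniz, euler_offspringSeries, euler_X, smul_eq_mul, smul_eq_mul, add_comm,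
    mul_left_comm, Finset.sum_mul]
  congr 1
  · split_ifs <;> simp [mul_comm]
  · refine Finset.sum_congr rfl fun l _ => ?_
    ring

/-- This is the probability of having no children: after removing the factor `X i`, only the
constant coefficient remains, and the inner series have none. -/
theorem coeff_single_populationSeries (A : Matrix (Fin m) (Fin m) ℝ) (p : Fin m → ℝ) (t : ℝ)
    (g : ℕ) (i : Fin m) :
    MvPowerSeries.coeff (Finsupp.single i 1) (populationSeries A p t (g + 1) i) =
      ∏ l, ENNReal.ofReal (Real.exp (-(t * A i l * p l).toNNReal)) := by
  simp only [populationSeries]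
  have h := MvPowerSeries.coeff_add_monomial_mul (Finsupp.single i 1) 0
    (offspringSeries A p t i (populationSeries A p t g)) (1 : ℝ≥0∞)
  rw [add_zero, one_mul, MvPowerSeries.coeff_zero_eq_constantCoeff_apply] at h
  rw [MvPowerSeries.X, h, offspringSeries, map_prod]
  exact Finset.prod_congr rfl fun l _ => constantCoeff_poissonSeries _ _
    (constantCoeff_populationSeries A p t g l)

end

/-! ### The generating function of the total progeny -/

open Filter in
-- Supplies the pointwise convergence of indicators that passes from truncated to total progeny; an
-- infinite total is allowed.
theorem eventually_sum_eq_iff_tsum_eq (z : ℕ → ℕ) (N : ℕ) :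
    ∀ᶠ g in atTop, (∑ h ∈ Finset.range (g + 1), z h = N ↔ ∑' h, (z h : ℝ≥0∞) = N) := by
  have hlim : Tendsto (fun g => ((∑ h ∈ Finset.range (g + 1), z h : ℕ) : ℝ≥0∞)) atTop
      (nhds (∑' h, (z h : ℝ≥0∞))) := by
    have := (ENNReal.tendsto_nat_tsum fun h => (z h : ℝ≥0∞)).comp (tendsto_add_atTop_nat 1)
    simpa [Function.comp_def] using this
  have hle : ∀ g, ((∑ h ∈ Finset.range (g + 1), z h : ℕ) : ℝ≥0∞) ≤ ∑' h, (z h : ℝ≥0∞) := fun g => by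
    push_cast
    exact ENNReal.sum_le_tsum _
  rcases lt_trichotomy (∑' h, (z h : ℝ≥0∞)) N with h | h | h
  · refine Eventually.of_forall fun g => iff_of_false (fun hg => ?_) h.ne
    exact absurd (hg ▸ hle g) (not_le.2 h)
  · have hev : ∀ᶠ g in atTop, N ≤ ∑ h ∈ Finset.range (g + 1), z h := by
      rcases Nat.eq_zero_or_pos N with h0 | h0
      · simp [h0]
      -- By integrality, a partial sum exceeding `N - 1` is at least `N`; hence the separate case `N
      -- = 0`.
      · have hlt : ((N - 1 : ℕ) : ℝ≥0∞) < ∑' h, (z h : ℝ≥0∞) := by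
          rw [h]
          exact Nat.cast_lt.2 (Nat.sub_lt h0 one_pos)
        filter_upwards [hlim.eventually_const_lt hlt] with g hg
        have := Nat.cast_lt.1 hg
        omega
    filter_upwards [hev] with g hg
    refine iff_of_true (le_antisymm ?_ hg) h
    exact Nat.cast_le.1 ((hle g).trans_eq h)
  · filter_upwards [hlim.eventually_const_lt h] with g hg
    exact iff_of_false (Nat.cast_lt.1 hg).ne' h.ne'

section

variable {m : ℕ} {Ω : Type*} [MeasurableSpace Ω]

/-- The generating function of the total progeny of an individual of type `i`. -/
def progenySeries (P : Measure Ω) (X : Fin m → ℕ × ℕ → Ω → (Fin m → ℕ)) (i : Fin m) :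
    MvPowerSeries (Fin m) ℝ :=
  fun n => P.real {ω | ∀ l, totalProgeny X i ω l = (n l : ℝ≥0∞)}

theorem coeff_progenySeries (P : Measure Ω) (X : Fin m → ℕ × ℕ → Ω → (Fin m → ℕ)) (i : Fin m)
    (n : Fin m →₀ ℕ) :
    MvPowerSeries.coeff n (progenySeries P X i) =
      P.real {ω | ∀ l, totalProgeny X i ω l = (n l : ℝ≥0∞)} := rfl

variable {P : Measure Ω} [IsProbabilityMeasure P] {X : Fin m → ℕ × ℕ → Ω → (Fin m → ℕ)}
  {A : Matrix (Fin m) (Fin m) ℝ} {p : Fin m → ℝ} {t : ℝ}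

open Filter in
theorem tendsto_coeff_populationSeries (hX : ∀ k q, Measurable (X k q))
    (h : IsOffspringFamily A p t P X) (i : Fin m) (n : Fin m →₀ ℕ) :
    Tendsto (fun g => (MvPowerSeries.coeff n (populationSeries A p t g i)).toReal) atTop
      (nhds (MvPowerSeries.coeff n (progenySeries P X i))) := by
  simp only [← measure_population hX h]
  refine (ENNReal.tendsto_toReal (measure_ne_top _ _)).comp
    (tendsto_measure_of_tendsto_indicator_of_isFiniteMeasure _ _ (fun g => ?_) fun ω => ?_)
  · exact (measurable_population i g).mono (offspringSigma_le hX _) le_rfl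
      (measurableSet_singleton (n : Fin m → ℕ))
  · filter_upwards [eventually_all.2 fun l =>
      eventually_sum_eq_iff_tsum_eq (fun h => generation X i h ω l) (n l)] with g hg
    simp only [funext_iff, population, Finset.sum_apply, totalProgeny]
    exact forall_congr' hg

theorem coeff_populationSeries_ne_top (hX : ∀ k q, Measurable (X k q))
    (h : IsOffspringFamily A p t P X) (i : Fin m) (g : ℕ) (n : Fin m →₀ ℕ) :
    MvPowerSeries.coeff n (populationSeries A p t g i) ≠ ∞ := by
  rw [← measure_population hX h]
  exact measure_ne_top _ _

theorem toReal_coeff_populationSeries (hX : ∀ k q, Measurable (X k q))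
    (h : IsOffspringFamily A p t P X) (hr : ∀ i l, 0 ≤ t * A i l * p l) (i k : Fin m) (g : ℕ)
    (n : Fin m →₀ ℕ) :
    n k * (MvPowerSeries.coeff n (populationSeries A p t (g + 1) i)).toReal =
      (if i = k then (MvPowerSeries.coeff n (populationSeries A p t (g + 1) i)).toReal else 0) +
        ∑ l, t * A i l * p l * ∑ x ∈ Finset.HasAntidiagonal.antidiagonal n,
          (MvPowerSeries.coeff x.1 (populationSeries A p t (g + 1) i)).toReal *
            (x.2 k * (MvPowerSeries.coeff x.2 (populationSeries A p t g l)).toReal) := by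
  classical
  have hfin := coeff_populationSeries_ne_top hX h
  have h1 := congrArg (fun f => (MvPowerSeries.coeff n f).toReal)
    (euler_populationSeries A p t g i k)
  simp only [coeff_euler, map_add, map_sum, MvPowerSeries.coeff_C_mul,
    ENNReal.toReal_mul, ENNReal.toReal_natCast] at h1
  simp only [MvPowerSeries.coeff_mul, coeff_euler] at h1
  have hx : ∀ l, ∀ x ∈ Finset.HasAntidiagonal.antidiagonal n,
      MvPowerSeries.coeff x.1 (populationSeries A p t (g + 1) i) *
        ((x.2 k : ℝ≥0∞) * MvPowerSeries.coeff x.2 (populationSeries A p t g l)) ≠ ∞ :=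
    fun l x _ => ENNReal.mul_ne_top (hfin _ _ _)
      (ENNReal.mul_ne_top (ENNReal.natCast_ne_top _) (hfin _ _ _))
  have hs : ∀ l ∈ Finset.univ, ((t * A i l * p l).toNNReal : ℝ≥0∞) *
      ∑ x ∈ Finset.HasAntidiagonal.antidiagonal n, MvPowerSeries.coeff x.1 (populationSeries A p t (g + 1) i) *
        ((x.2 k : ℝ≥0∞) * MvPowerSeries.coeff x.2 (populationSeries A p t g l)) ≠ ∞ :=
    fun l _ => ENNReal.mul_ne_top ENNReal.coe_ne_top (ENNReal.sum_ne_top.2 (hx l))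
  rw [h1, ENNReal.toReal_add _ (ENNReal.sum_ne_top.2 hs), ENNReal.toReal_sum hs]
  · congr 1
    · split_ifs <;> simp
    · refine Finset.sum_congr rfl fun l _ => ?_
      rw [ENNReal.toReal_mul, ENNReal.toReal_sum (hx l), ENNReal.coe_toReal,
        Real.coe_toNNReal _ (hr i l)]
      simp only [ENNReal.toReal_mul, ENNReal.toReal_natCast]
  · split_ifs
    · exact hfin _ _ _
    · simp

/-- Each coefficient of the truncated identity is a polynomial in finitely many coefficients, so it
passes to the limit in the number of generations. -/
theorem euler_progenySeries (hX : ∀ k q, Measurable (X k q))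
    (h : IsOffspringFamily A p t P X) (hr : ∀ i l, 0 ≤ t * A i l * p l) (i k : Fin m) :
    euler k (progenySeries P X i) =
      (if i = k then progenySeries P X i else 0) +
        ∑ l, (t * A i l * p l) • (progenySeries P X i * euler k (progenySeries P X l)) := by
  classical
  ext n
  simp only [coeff_euler, map_add, map_sum, map_smul, smul_eq_mul, MvPowerSeries.coeff_mul]
  have hlim := tendsto_coeff_populationSeries hX h
  have hlim' := fun i n => (hlim i n).comp (Filter.tendsto_add_atTop_nat 1)
  refine tendsto_nhds_unique ((hlim' i n).const_mul (n k : ℝ)) ?_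
  have h2 := fun g => toReal_coeff_populationSeries hX h hr i k g n
  simp only [Function.comp_def, h2]
  refine Filter.Tendsto.add ?_ (tendsto_finsetSum _ fun l _ => Filter.Tendsto.const_mul _
    (tendsto_finsetSum _ fun x _ => (hlim' i x.1).mul ((hlim l x.2).const_mul _)))
  split_ifs
  · exact hlim' i n
  · simp

theorem coeff_single_progenySeries (hX : ∀ k q, Measurable (X k q))
    (h : IsOffspringFamily A p t P X) (hr : ∀ i l, 0 ≤ t * A i l * p l) (i : Fin m) :
    MvPowerSeries.coeff (Finsupp.single i 1) (progenySeries P X i) =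
      Real.exp (-∑ l, t * A i l * p l) := by
  refine tendsto_nhds_unique ((tendsto_coeff_populationSeries hX h i _).comp
    (Filter.tendsto_add_atTop_nat 1)) ?_
  simp only [Function.comp_def, coeff_single_populationSeries, ENNReal.toReal_prod]
  rw [← Finset.sum_neg_distrib, Real.exp_sum]
  have : ∀ l, (ENNReal.ofReal (Real.exp (-(t * A i l * p l).toNNReal))).toReal =
      Real.exp (-(t * A i l * p l)) := fun l => by
    rw [ENNReal.toReal_ofReal (Real.exp_pos _).le, Real.coe_toNNReal _ (hr i l)]
  simp only [this]
  exact tendsto_const_nhds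

end

/-! ### The dissymmetry identity -/

section

variable {m : ℕ}

/-- The series `∑ pᵢ Qᵢ - (t / 2) ∑ Aᵢⱼ pᵢ pⱼ Qᵢ Qⱼ`. -/
def clusterSeries (A : Matrix (Fin m) (Fin m) ℝ) (p : Fin m → ℝ) (t : ℝ)
    (Q : Fin m → MvPowerSeries (Fin m) ℝ) : MvPowerSeries (Fin m) ℝ :=
  ∑ i, p i • Q i - (t / 2) • ∑ i, ∑ j, (A i j * p i * p j) • (Q i * Q j)

variable {A : Matrix (Fin m) (Fin m) ℝ} {p : Fin m → ℝ} {t : ℝ}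
  {Q : Fin m → MvPowerSeries (Fin m) ℝ}

/-- The linear part contributes `p k • Q k` plus `t` times a bilinear sum. By symmetry of `A`, the
product rule gives twice that sum in the quadratic part, and the factor `t / 2` makes it cancel. -/
theorem euler_clusterSeries (hA : A.IsSymm)
    (hQ : ∀ i k, euler k (Q i) = (if i = k then Q i else 0) +
      ∑ l, (t * A i l * p l) • (Q i * euler k (Q l))) (k : Fin m) :
    euler k (clusterSeries A p t Q) = p k • Q k := by
  have h1 : ∑ i, p i • euler k (Q i) =
      p k • Q k + t • ∑ i, ∑ j, (A i j * p i * p j) • (Q i * euler k (Q j)) := by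
    conv_lhs => enter [2, i]; rw [hQ i k]
    simp only [smul_add, Finset.sum_add_distrib, Finset.smul_sum, smul_smul, smul_ite, smul_zero,
      Finset.sum_ite_eq', Finset.mem_univ, if_true]
    congr 1
    refine Finset.sum_congr rfl fun i _ => Finset.sum_congr rfl fun j _ => ?_
    congr 1
    ring
  have h2 : ∑ i, ∑ j, (A i j * p i * p j) • (Q j * euler k (Q i)) =
      ∑ i, ∑ j, (A i j * p i * p j) • (Q i * euler k (Q j)) := by
    rw [Finset.sum_comm]
    refine Finset.sum_congr rfl fun i _ => Finset.sum_congr rfl fun j _ => ?_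
    rw [hA.apply i j]
    congr 1
    ring
  simp only [clusterSeries, map_sub, map_sum, Derivation.map_smul, Derivation.leibniz, smul_add,
    Finset.sum_add_distrib, smul_eq_mul]
  rw [h1, h2, ← add_smul, add_halves, add_sub_cancel_right]

/-- Since `∑ k, p k • Q k` is the linear part of the cluster series, the difference is its quadratic
part, rewritten through `p i • Q i = D i V`. -/
theorem sum_euler_clusterSeries (hA : A.IsSymm)
    (hQ : ∀ i k, euler k (Q i) = (if i = k then Q i else 0) +
      ∑ l, (t * A i l * p l) • (Q i * euler k (Q l))) :
    ∑ k, euler k (clusterSeries A p t Q) - clusterSeries A p t Q =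
      (t / 2) • ∑ i, ∑ j, A i j •
        (euler i (clusterSeries A p t Q) * euler j (clusterSeries A p t Q)) := by
  simp only [euler_clusterSeries hA hQ]
  rw [clusterSeries, sub_sub_cancel]
  simp only [smul_mul_smul_comm, smul_smul, mul_assoc]

end

/-! ### The explicit solution of the reduced equation -/

section

variable {m : ℕ}

theorem kernel_zero_left (A : Matrix (Fin m) (Fin m) ℝ) (n : Fin m → ℕ) : kernel A 0 n = 0 := by
  simp [kernel]

theorem kernel_zero_right (A : Matrix (Fin m) (Fin m) ℝ) (n : Fin m → ℕ) : kernel A n 0 = 0 := by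
  simp [kernel]

/-- Makes every recursion below triangular in the total size: the terms `k = 0` and `k = n` carry a
zero kernel. -/
theorem kernel_eq_zero_or_lt (A : Matrix (Fin m) (Fin m) ℝ) {k n : Fin m → ℕ} (h : k ≤ n) :
    kernel A k (n - k) = 0 ∨ 0 < ∑ i, k i ∧ 0 < ∑ i, (n - k) i ∧
      ∑ i, k i < ∑ i, n i ∧ ∑ i, (n - k) i < ∑ i, n i := by
  have hs : ∑ i, k i + ∑ i, (n - k) i = ∑ i, n i := by
    rw [← Finset.sum_add_distrib]
    exact Finset.sum_congr rfl fun i _ => Nat.add_sub_of_le (h i)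
  by_cases h1 : k = 0
  · subst h1
    exact Or.inl (kernel_zero_left A _)
  by_cases h2 : n - k = 0
  · rw [h2]
    exact Or.inl (kernel_zero_right A _)
  have hpos : ∀ v : Fin m → ℕ, v ≠ 0 → 0 < ∑ i, v i := fun v hv => by
    rw [Nat.pos_iff_ne_zero]
    contrapose! hv
    funext i
    exact Finset.sum_eq_zero_iff.1 hv i (Finset.mem_univ i)
  have := hpos _ h1
  have := hpos _ h2
  omega

theorem eq_single_of_sum_eq_one {n : Fin m → ℕ} (h : ∑ i, n i = 1) : ∃ i, n = Pi.single i 1 := by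
  obtain ⟨i, -, hi⟩ := Finset.exists_ne_zero_of_sum_ne_zero (h.trans_ne one_ne_zero)
  refine ⟨i, ?_⟩
  have h1 := Finset.add_sum_erase Finset.univ n (Finset.mem_univ i)
  have h2 : ∑ j ∈ Finset.univ.erase i, n j = 0 := by omega
  funext j
  by_cases hj : j = i
  · subst hj
    simp
    omega
  · rw [Pi.single_eq_of_ne hj]
    exact Finset.sum_eq_zero_iff.1 h2 j (by simp [hj])

/-- The coefficients `aₙ` of the solution `t ^ (|n| - 1) exp (-nᵀ A p t) aₙ` of the reduced
equation. -/
def treeCoeff (A : Matrix (Fin m) (Fin m) ℝ) (p : Fin m → ℝ) (n : Fin m → ℕ) : ℝ :=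
  if ∑ i, n i = 1 then ∑ i, n i * p i
  else ((∑ i, n i : ℕ) - 1 : ℝ)⁻¹ * (1 / 2 * ∑ k ∈ Finset.Iic n,
    if _ : ∑ i, k i < ∑ i, n i ∧ ∑ i, (n - k) i < ∑ i, n i then
      kernel A k (n - k) * treeCoeff A p k * treeCoeff A p (n - k)
    else 0)
termination_by ∑ i, n i
decreasing_by
  all_goals tauto

theorem treeCoeff_single (A : Matrix (Fin m) (Fin m) ℝ) (p : Fin m → ℝ) (i : Fin m) :
    treeCoeff A p (Pi.single i 1) = p i := by
  rw [treeCoeff, if_pos (by simp)]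
  simp [Pi.single_apply]

/-- The guard in `treeCoeff` serves termination only: where it fails, the kernel vanishes. At total
size one both sides are zero. -/
theorem treeCoeff_recursion (A : Matrix (Fin m) (Fin m) ℝ) (p : Fin m → ℝ) (n : Fin m → ℕ) :
    ((∑ i, n i : ℕ) - 1 : ℝ) * treeCoeff A p n =
      1 / 2 * ∑ k ∈ Finset.Iic n, kernel A k (n - k) * treeCoeff A p k * treeCoeff A p (n - k) := by
  by_cases h : ∑ i, n i = 1
  · rw [h, Nat.cast_one, sub_self, zero_mul, Finset.sum_eq_zero, mul_zero]
    intro k hk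
    rcases kernel_eq_zero_or_lt A (Finset.mem_Iic.1 hk) with h0 | h0
    · simp [h0]
    · omega
  · have h1 : ((∑ i, n i : ℕ) - 1 : ℝ) ≠ 0 := sub_ne_zero.2 (by exact_mod_cast h)
    rw [treeCoeff, if_neg h, mul_inv_cancel_left₀ h1]
    congr 1
    refine Finset.sum_congr rfl fun k hk => ?_
    split_ifs with hc
    · rfl
    · rcases kernel_eq_zero_or_lt A (Finset.mem_Iic.1 hk) with h0 | h0
      · simp [h0]
      · exact absurd h0.2.2 hc

/-- The factor `|n| - 1` vanishes only at unit vectors, so their values are the only free data. -/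
theorem eq_of_recursion {A : Matrix (Fin m) (Fin m) ℝ} {c : ℝ} {x y : (Fin m → ℕ) → ℝ}
    (hx : ∀ n, ((∑ i, n i : ℕ) - 1 : ℝ) * x n =
      c * ∑ k ∈ Finset.Iic n, kernel A k (n - k) * x k * x (n - k))
    (hy : ∀ n, ((∑ i, n i : ℕ) - 1 : ℝ) * y n =
      c * ∑ k ∈ Finset.Iic n, kernel A k (n - k) * y k * y (n - k))
    (hxy : ∀ i, x (Pi.single i 1) = y (Pi.single i 1)) (n : Fin m → ℕ) : x n = y n := by
  induction hN : ∑ i, n i using Nat.strong_induction_on generalizing n with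
  | _ N ih =>
    subst hN
    by_cases h : ∑ i, n i = 1
    · obtain ⟨i, rfl⟩ := eq_single_of_sum_eq_one h
      exact hxy i
    · refine mul_left_cancel₀ (sub_ne_zero.2 (by exact_mod_cast h) :
        ((∑ i, n i : ℕ) - 1 : ℝ) ≠ 0) ?_
      rw [hx, hy]
      congr 1
      refine Finset.sum_congr rfl fun k hk => ?_
      rcases kernel_eq_zero_or_lt A (Finset.mem_Iic.1 hk) with h0 | ⟨-, -, h1, h2⟩
      · simp [h0]
      · rw [ih _ h1 k rfl, ih _ h2 (n - k) rfl]

/-- The rate `nᵀ A p`. -/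
def lossRate (A : Matrix (Fin m) (Fin m) ℝ) (p : Fin m → ℝ) (n : Fin m → ℕ) : ℝ :=
  ∑ i, ∑ j, (n i : ℝ) * A i j * p j

theorem lossRate_add_sub (A : Matrix (Fin m) (Fin m) ℝ) (p : Fin m → ℝ) {k n : Fin m → ℕ}
    (h : k ≤ n) : lossRate A p k + lossRate A p (n - k) = lossRate A p n := by
  simp only [lossRate, ← Finset.sum_add_distrib, ← add_mul]
  refine Finset.sum_congr rfl fun i _ => Finset.sum_congr rfl fun j _ => ?_
  rw [Pi.sub_apply, Nat.cast_sub (h i), add_sub_cancel]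

theorem lossRate_single (A : Matrix (Fin m) (Fin m) ℝ) (p : Fin m → ℝ) (i : Fin m) :
    lossRate A p (Pi.single i 1) = ∑ j, A i j * p j := by
  rw [lossRate, Finset.sum_eq_single i] <;> simp +contextual

/-- The solution of the reduced equation with monodisperse initial condition. -/
def explicitSolution (A : Matrix (Fin m) (Fin m) ℝ) (p : Fin m → ℝ) (n : Fin m → ℕ) (t : ℝ) : ℝ :=
  t ^ (∑ i, n i - 1) * Real.exp (-(lossRate A p n * t)) * treeCoeff A p n

theorem explicitSolution_single (A : Matrix (Fin m) (Fin m) ℝ) (p : Fin m → ℝ) (i : Fin m)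
    (t : ℝ) :
    explicitSolution A p (Pi.single i 1) t = Real.exp (-((∑ j, A i j * p j) * t)) * p i := by
  simp [explicitSolution, treeCoeff_single, lossRate_single]

theorem gain_explicitSolution (A : Matrix (Fin m) (Fin m) ℝ) (p : Fin m → ℝ) (n : Fin m → ℕ)
    (t : ℝ) :
    1 / 2 * ∑ k ∈ Finset.Iic n,
        kernel A k (n - k) * explicitSolution A p k t * explicitSolution A p (n - k) t =
      ((∑ i, n i : ℕ) - 1 : ℝ) * treeCoeff A p n *
        (t ^ (∑ i, n i - 2) * Real.exp (-(lossRate A p n * t))) := by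
  rw [treeCoeff_recursion, mul_assoc, Finset.sum_mul]
  congr 1
  refine Finset.sum_congr rfl fun k hk => ?_
  rcases kernel_eq_zero_or_lt A (Finset.mem_Iic.1 hk) with h0 | ⟨h1, h2, -, -⟩
  · simp [h0]
  · have hs : ∑ i, k i + ∑ i, (n - k) i = ∑ i, n i := by
      rw [← Finset.sum_add_distrib]
      exact Finset.sum_congr rfl fun i _ => Nat.add_sub_of_le (Finset.mem_Iic.1 hk i)
    -- Both parts are nonzero here, so no subtraction truncates.
    have he : ∑ i, n i - 2 = (∑ i, k i - 1) + (∑ i, (n - k) i - 1) := by omega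
    rw [he, ← lossRate_add_sub A p (Finset.mem_Iic.1 hk), add_mul, neg_add, Real.exp_add, pow_add]
    simp only [explicitSolution]
    ring

theorem treeCoeff_zero (A : Matrix (Fin m) (Fin m) ℝ) (p : Fin m → ℝ) : treeCoeff A p 0 = 0 := by
  have h := treeCoeff_recursion A p 0
  have h0 : (Finset.Iic (0 : Fin m → ℕ)) = {0} := by
    ext k
    simp
  rw [h0, Finset.sum_singleton, kernel_zero_left] at h
  simpa using h

/-- The powers of `t` and the exponentials factor through the convolution, leaving at fixed `t` an
algebraic recursion free of time derivatives: the one satisfied by the cluster series. -/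
theorem explicitSolution_recursion (A : Matrix (Fin m) (Fin m) ℝ) (p : Fin m → ℝ)
    (n : Fin m → ℕ) (t : ℝ) :
    ((∑ i, n i : ℕ) - 1 : ℝ) * explicitSolution A p n t =
      t / 2 * ∑ k ∈ Finset.Iic n,
        kernel A k (n - k) * explicitSolution A p k t * explicitSolution A p (n - k) t := by
  rw [div_eq_mul_one_div t, mul_assoc, gain_explicitSolution, explicitSolution]
  rcases Nat.lt_or_ge (∑ i, n i) 2 with h | h
  · by_cases h1 : ∑ i, n i = 1
    · simp [h1]
    · have : n = 0 := by
        have h0 : ∑ i, n i = 0 := by omega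
        funext i
        exact Finset.sum_eq_zero_iff.1 h0 i (Finset.mem_univ i)
      simp [this, treeCoeff_zero]
  · rw [show ∑ i, n i - 1 = (∑ i, n i - 2) + 1 by omega, pow_succ]
    ring

theorem hasDerivAt_explicitSolution (A : Matrix (Fin m) (Fin m) ℝ) (p : Fin m → ℝ)
    (n : Fin m → ℕ) (t : ℝ) :
    HasDerivAt (explicitSolution A p n)
      (1 / 2 * ∑ k ∈ Finset.Iic n,
        kernel A k (n - k) * explicitSolution A p k t * explicitSolution A p (n - k) t -
          lossRate A p n * explicitSolution A p n t) t := by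
  have h1 := (((hasDerivAt_pow (∑ i, n i - 1) t).mul
    ((hasDerivAt_id t).const_mul (lossRate A p n)).neg.exp).mul_const (treeCoeff A p n))
  refine h1.congr_deriv ?_
  rw [gain_explicitSolution, explicitSolution, Nat.sub_sub]
  simp only [id, Pi.neg_apply]
  -- At `n = 0` the exponent `|n| - 1` truncates, but there the coefficient is zero.
  rcases Nat.eq_zero_or_pos (∑ i, n i) with h | h
  · have : n = 0 := by
      funext i
      exact Finset.sum_eq_zero_iff.1 h i (Finset.mem_univ i)
    simp [this, treeCoeff_zero]
  · rw [Nat.cast_sub h]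
    push_cast
    ring

variable {A : Matrix (Fin m) (Fin m) ℝ} {p : Fin m → ℝ}

theorem massVector_zero {w : (Fin m → ℕ) → ℝ → ℝ} (h1 : ∀ i, w (Pi.single i 1) 0 = p i)
    (h2 : ∀ n, (∀ i, n ≠ Pi.single i 1) → w n 0 = 0) (j : Fin m) : massVector w 0 j = p j := by
  rw [massVector, tsum_eq_single (Pi.single j 1)]
  · simp [h1]
  · intro n hn
    by_cases h : ∃ i, n = Pi.single i 1
    · obtain ⟨i, rfl⟩ := h
      have hij : j ≠ i := fun hji => hn (by rw [hji])
      simp [hij]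
    · rw [h2 n (by simpa using h), mul_zero]

theorem isReducedSolution_explicitSolution (A : Matrix (Fin m) (Fin m) ℝ) (p : Fin m → ℝ)
    (T : ℝ≥0∞) : IsReducedSolution A p T (explicitSolution A p) := by
  have h1 : ∀ i, explicitSolution A p (Pi.single i 1) 0 = p i := fun i => by
    simp [explicitSolution_single]
  have h2 : ∀ n, (∀ i, n ≠ Pi.single i 1) → explicitSolution A p n 0 = 0 := fun n hn => by
    have hne : ∑ i, n i ≠ 1 := fun h => by
      obtain ⟨i, hi⟩ := eq_single_of_sum_eq_one h
      exact hn i hi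
    rcases Nat.eq_zero_or_pos (∑ i, n i) with h | h
    · have : n = 0 := by
        funext i
        exact Finset.sum_eq_zero_iff.1 h i (Finset.mem_univ i)
      simp [this, explicitSolution, treeCoeff_zero]
    · rw [explicitSolution, zero_pow (by omega), zero_mul, zero_mul]
  refine ⟨h1, h2, fun n t _ _ => ?_⟩
  have h3 := (hasDerivAt_explicitSolution A p n t).hasDerivWithinAt (s := Set.Ici 0)
  simpa only [reducedRHS, massVector_zero h1 h2, lossRate] using h3

/-! ### Uniqueness for the reduced equation -/

/-- Induction on the total size: the gain terms involve only smaller clusters and hence coincide.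
The difference then solves a linear homogeneous equation, and its product with the integrating
factor is constant. -/
theorem IsReducedSolution.unique {T : ℝ≥0∞} {w w' : (Fin m → ℕ) → ℝ → ℝ}
    (h : IsReducedSolution A p T w) (h' : IsReducedSolution A p T w') (n : Fin m → ℕ) {t : ℝ}
    (ht : 0 ≤ t) (htT : ENNReal.ofReal t < T) : w n t = w' n t := by
  induction hN : ∑ i, n i using Nat.strong_induction_on generalizing n t with
  | _ N ih =>
    subst hN
    have hlt : ∀ s, s ≤ t → ENNReal.ofReal s < T := fun s hs =>
      (ENNReal.ofReal_le_ofReal hs).trans_lt htT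
    have hd : ∀ s, 0 ≤ s → s ≤ t → HasDerivWithinAt
        (fun s => (w n s - w' n s) * Real.exp (lossRate A p n * s)) 0 (Set.Ici 0) s := by
      intro s hs0 hst
      have h1 := (h.equation n s hs0 (hlt s hst)).sub (h'.equation n s hs0 (hlt s hst))
      have h2 := (((hasDerivAt_id s).const_mul (lossRate A p n)).exp).hasDerivWithinAt
        (s := Set.Ici (0 : ℝ))
      refine (h1.mul h2).congr_deriv ?_
      have hg : ∑ k ∈ Finset.Iic n, kernel A k (n - k) * w k s * w (n - k) s =
          ∑ k ∈ Finset.Iic n, kernel A k (n - k) * w' k s * w' (n - k) s := by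
        refine Finset.sum_congr rfl fun k hk => ?_
        rcases kernel_eq_zero_or_lt A (Finset.mem_Iic.1 hk) with h0 | ⟨-, -, hk1, hk2⟩
        · simp [h0]
        · rw [ih _ hk1 k hs0 (hlt s hst) rfl, ih _ hk2 (n - k) hs0 (hlt s hst) rfl]
      simp only [reducedRHS, hg, massVector_zero h.initial_single h.initial_other,
        massVector_zero h'.initial_single h'.initial_other, id, Pi.sub_apply, lossRate]
      ring
    have hc := constant_of_has_deriv_right_zero
      (f := fun s => (w n s - w' n s) * Real.exp (lossRate A p n * s)) (a := 0) (b := t)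
      (fun s hs => ((hd s hs.1 hs.2).continuousWithinAt).mono fun x hx => hx.1)
      (fun s hs => (hd s hs.1 hs.2.le).mono (Set.Ici_subset_Ici.2 hs.1)) t ⟨ht, le_rfl⟩
    have h0 : w n 0 = w' n 0 := by
      by_cases hn : ∃ i, n = Pi.single i 1
      · obtain ⟨i, rfl⟩ := hn
        rw [h.initial_single, h'.initial_single]
      · rw [h.initial_other n (by simpa using hn), h'.initial_other n (by simpa using hn)]
    rw [h0, sub_self, zero_mul, mul_eq_zero, or_iff_left (Real.exp_pos _).ne'] at hc
    exact sub_eq_zero.1 hc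

/-! ### The solution and the total progeny -/

theorem sum_antidiagonal_eq_sum_Iic (n : Fin m →₀ ℕ) (f : (Fin m → ℕ) → (Fin m → ℕ) → ℝ) :
    ∑ x ∈ Finset.HasAntidiagonal.antidiagonal n, f x.1 x.2 = ∑ k ∈ Finset.Iic (n : Fin m → ℕ), f k (n - k) := by
  classical
  refine Finset.sum_bij' (fun x _ => (x.1 : Fin m → ℕ))
    (fun k _ => (Finsupp.equivFunOnFinite.symm k, n - Finsupp.equivFunOnFinite.symm k))
    ?_ ?_ ?_ ?_ ?_
  · intro x hx
    rw [← Finset.HasAntidiagonal.mem_antidiagonal.1 hx, Finset.mem_Iic]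
    intro i
    simp
  · intro k hk
    rw [Finset.HasAntidiagonal.mem_antidiagonal]
    ext i
    simpa using Nat.add_sub_of_le (Finset.mem_Iic.1 hk i)
  · intro x hx
    rw [← Finset.HasAntidiagonal.mem_antidiagonal.1 hx]
    ext i <;> simp
  · intro k hk
    rfl
  · intro x hx
    rw [← Finset.HasAntidiagonal.mem_antidiagonal.1 hx, Finsupp.coe_add, add_tsub_cancel_left]

theorem coeff_clusterSeries_recursion {t : ℝ} {Q : Fin m → MvPowerSeries (Fin m) ℝ}
    (hA : A.IsSymm)
    (hQ : ∀ i k, euler k (Q i) = (if i = k then Q i else 0) +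
      ∑ l, (t * A i l * p l) • (Q i * euler k (Q l))) (n : Fin m → ℕ) :
    ((∑ i, n i : ℕ) - 1 : ℝ) *
        MvPowerSeries.coeff (Finsupp.equivFunOnFinite.symm n) (clusterSeries A p t Q) =
      t / 2 * ∑ k ∈ Finset.Iic n, kernel A k (n - k) *
        MvPowerSeries.coeff (Finsupp.equivFunOnFinite.symm k) (clusterSeries A p t Q) *
        MvPowerSeries.coeff (Finsupp.equivFunOnFinite.symm (n - k)) (clusterSeries A p t Q) := by
  classical
  have h := congrArg (MvPowerSeries.coeff (Finsupp.equivFunOnFinite.symm n))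
    (sum_euler_clusterSeries hA hQ)
  simp only [map_sub, map_sum, map_smul, coeff_euler, smul_eq_mul, MvPowerSeries.coeff_mul,
    Finset.mul_sum] at h
  rw [← Finset.sum_mul, ← sub_one_mul] at h
  push_cast
  refine h.trans ?_
  rw [Finset.mul_sum]
  refine Eq.trans ?_ (sum_antidiagonal_eq_sum_Iic (Finsupp.equivFunOnFinite.symm n) fun a b =>
    t / 2 * (kernel A a b *
      MvPowerSeries.coeff (Finsupp.equivFunOnFinite.symm a) (clusterSeries A p t Q) *
      MvPowerSeries.coeff (Finsupp.equivFunOnFinite.symm b) (clusterSeries A p t Q)))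
  simp only [kernel, Finset.mul_sum, Finset.sum_mul]
  conv_rhs => rw [Finset.sum_comm]
  refine Finset.sum_congr rfl fun i _ => ?_
  conv_rhs => rw [Finset.sum_comm]
  refine Finset.sum_congr rfl fun j _ => Finset.sum_congr rfl fun x _ => ?_
  simp only [Finsupp.equivFunOnFinite_symm_coe]
  ring

theorem explicitSolution_eq_progeny {Ω : Type*} [MeasurableSpace Ω] {P : Measure Ω}
    [IsProbabilityMeasure P] {X : Fin m → ℕ × ℕ → Ω → (Fin m → ℕ)} {t : ℝ}
    (hA : A.IsSymm) (hr : ∀ i l, 0 ≤ t * A i l * p l) (hX : ∀ k q, Measurable (X k q))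
    (h : IsOffspringFamily A p t P X) (n : Fin m → ℕ) (i : Fin m) (hi : 0 < n i) :
    explicitSolution A p n t =
      p i / n i * P.real {ω | ∀ l, totalProgeny X i ω l = (n l : ℝ≥0∞)} := by
  have hQ := euler_progenySeries hX h hr
  have hV := euler_clusterSeries hA hQ
  have hcoeff : ∀ (n : Fin m →₀ ℕ) (i : Fin m),
      n i * MvPowerSeries.coeff n (clusterSeries A p t (progenySeries P X)) =
        p i * MvPowerSeries.coeff n (progenySeries P X i) := fun n i => by
    rw [← coeff_euler, hV, map_smul, smul_eq_mul]
  have hsingle : ∀ i : Fin m, Finsupp.equivFunOnFinite.symm (Pi.single i 1) =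
      (Finsupp.single i 1 : Fin m →₀ ℕ) := fun i => by
    classical
    ext j
    simp [Finsupp.single_apply]
  have heq := eq_of_recursion (fun n => explicitSolution_recursion A p n t)
    (coeff_clusterSeries_recursion hA hQ) (fun i => by
      have h1 := hcoeff (Finsupp.single i 1) i
      rw [coeff_single_progenySeries hX h hr, Finsupp.single_eq_same, Nat.cast_one, one_mul] at h1
      rw [hsingle, h1, explicitSolution_single, mul_comm, Finset.sum_mul]
      congr 3
      refine Finset.sum_congr rfl fun l _ => ?_
      ring) n
  have h2 := hcoeff (Finsupp.equivFunOnFinite.symm n) i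
  rw [← heq, coeff_progenySeries] at h2
  have hn : (n i : ℝ) ≠ 0 := by exact_mod_cast hi.ne'
  rw [div_mul_eq_mul_div, eq_div_iff hn, mul_comm]
  exact h2

/-! ### Removal of the measurability assumption, and the theorem -/

theorem generation_congr {Ω : Type*} {X Y : Fin m → ℕ × ℕ → Ω → (Fin m → ℕ)} {ω : Ω}
    (h : ∀ k q, X k q ω = Y k q ω) (i : Fin m) (g : ℕ) :
    generation X i g ω = generation Y i g ω := by
  induction g with
  | zero => rfl
  | succ g ih => simp only [generation, ih, h]

/-- `HasLaw` gives only almost everywhere measurability. The countably many offspring vectors agree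
simultaneously, off one null set, with measurable versions, and there the progenies coincide. -/
theorem explicitSolution_eq_progeny_of_aemeasurable {Ω : Type*} [MeasurableSpace Ω]
    {P : Measure Ω} [IsProbabilityMeasure P] {X : Fin m → ℕ × ℕ → Ω → (Fin m → ℕ)} {t : ℝ}
    (hA : A.IsSymm) (hr : ∀ i l, 0 ≤ t * A i l * p l)
    (h : IsOffspringFamily A p t P X) (n : Fin m → ℕ) (i : Fin m) (hi : 0 < n i) :
    explicitSolution A p n t =
      p i / n i * P.real {ω | ∀ l, totalProgeny X i ω l = (n l : ℝ≥0∞)} := by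
  have hm := fun k q => (h.law k q).aemeasurable
  have hY : IsOffspringFamily A p t P fun k q => (hm k q).mk (X k q) :=
    ⟨h.indep.congr fun q => (hm q.1 q.2).ae_eq_mk,
      fun k q => (h.law k q).congr (hm k q).ae_eq_mk.symm⟩
  rw [explicitSolution_eq_progeny hA hr (fun k q => (hm k q).measurable_mk) hY n i hi]
  congr 1
  refine measureReal_congr ?_
  have hae : ∀ᵐ ω ∂P, ∀ k q, X k q ω = (hm k q).mk (X k q) ω :=
    ae_all_iff.2 fun k => ae_all_iff.2 fun q => (hm k q).ae_eq_mk
  filter_upwards [hae] with ω hω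
  refine propext (forall_congr' fun l => ?_)
  simp only [totalProgeny, generation_congr hω]

end

end

end Coagulation

theorem corollary2 {m : ℕ} (A : Matrix (Fin m) (Fin m) ℝ) (hsymm : A.IsSymm)
    (hirr : A.IsIrreducible) (p : Fin m → ℝ) (hp : ∀ i, 0 ≤ p i) (hsum : ∑ i, p i = 1) :
    (∃ w : (Fin m → ℕ) → ℝ → ℝ,
      Coagulation.IsReducedSolution A p (Coagulation.criticalTime A p) w) ∧
    ∀ w : (Fin m → ℕ) → ℝ → ℝ,
      Coagulation.IsReducedSolution A p (Coagulation.criticalTime A p) w →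
      ∀ t : ℝ, 0 < t → ENNReal.ofReal t < Coagulation.criticalTime A p →
      ∀ (Ω : Type*) [MeasurableSpace Ω] (P : MeasureTheory.Measure Ω)
        [MeasureTheory.IsProbabilityMeasure P] (X : Fin m → ℕ × ℕ → Ω → (Fin m → ℕ)),
        Coagulation.IsOffspringFamily A p t P X →
        ∀ (n : Fin m → ℕ) (i : Fin m), 0 < n i →
          w n t = p i / (n i : ℝ) *
            P.real {ω | ∀ l, Coagulation.totalProgeny X i ω l = (n l : ENNReal)} := by
  have hw := Coagulation.isReducedSolution_explicitSolution A p (Coagulation.criticalTime A p)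
  refine ⟨⟨_, hw⟩, fun w h t ht htT Ω _ P _ X hX n i hi => ?_⟩
  rw [h.unique hw n ht.le htT]
  exact Coagulation.explicitSolution_eq_progeny_of_aemeasurable hsymm
    (fun i l => mul_nonneg (mul_nonneg ht.le (hirr.nonneg i l)) (hp l)) hX n i hi
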